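/- Let $p,q\ge 1$ be integers, let $\sigma=\frac{p+\sqrt{p^2+4q}}{2}$ be the metallic number and $\overline\sigma=p-\sigma$. Let $(\overline M,\overline g,J)$ be a locally metallic Riemannian manifold, that is, a Riemannian manifold with a smooth $(1,1)$-tensor field $J$ such that $J^2=pJ+qI$, $\overline g(JU,V)=\overline g(U,JV)$, and $\overline\nabla J=0$ for the Levi-Civita connection $\overline\nabla$ of $\overline g$ (for $p=q=1$: a locally Golden Riemannian manifold). Let $(M_1,g_1)$ and $(M_2,g_2)$ be Riemannian manifolds with $\dim M_2>0$, let $f:M_1\to(0,\infty)$ be smooth, and let $i:M=M_1\times_f M_2\to\overline M$ be an isometric immersion of the warped product, i.e. of $M_1\times M_2$ with the metric $g=\pi_1^*g_1+(f\circ\pi_1)^2\pi_2^*g_2$. Suppose that $M_1$ and $M_2$ are invariant submanifolds of $\overline M$, i.e. $J$ maps the tangent spaces of each leaf $M_1\times\{y\}$ and of each leaf $\{x\}\times M_2$ into themselves. For a smooth vector field $X$ on $M_1$, identified with its horizontal lift to $M$, let $TX=(JX)^T$ be the component of $JX$ tangent to $M$, and regard $X(\ln f)$ and $TX(\ln f)$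 as functions on $M$ (with $f$ standing for $f\circ\pi_1$). Then: 1. At every point of $M$ where $X(\ln f)\neq 0$, the ratio $\alpha=\frac{TX(\ln f)}{X(\ln f)}$ satisfies $\alpha^2-p\alpha-q=0$, and hence $TX(\ln f)=\sigma\,X(\ln f)$ or $TX(\ln f)=\overline\sigma\,X(\ln f)$ at that point. 2. On every connected subset of $M$ on which $X(\ln f)$ has no zero (in particular on $M$ itself, if $M$ is connected and $X(\ln f)$ vanishes nowhere), one and the same of the two equalities $TX(\ln f)=\sigma\,X(\ln f)$, $TX(\ln f)=\overline\sigma\,X(\ln f)$ holds throughout. -/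

import Mathlib

open Bundle Manifold
open scoped ContDiff

/-- The metallic number `σ_{p,q} = (p + √(p² + 4q)) / 2`. -/
noncomputable def metallicNumber (p q : ℕ) : ℝ :=
  ((p : ℝ) + Real.sqrt ((p : ℝ) ^ 2 + 4 * (q : ℝ))) / 2

section Ambient

variable {E : Type*} [NormedAddCommGroup E] [NormedSpace ℝ E]
  {H : Type*} [TopologicalSpace H] (I : ModelWithCorners ℝ E H)
  {M : Type*} [TopologicalSpace M] [ChartedSpace H M]

/-- The function `X(φ)` at the point `x`: the derivative of `φ` along the vector field `X`. -/
noncomputable def derivAlong (X : (x : M) → TangentSpace I x) (φ : M → ℝ) (x : M) : ℝ :=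
  mfderiv I 𝓘(ℝ, ℝ) φ x (X x)

variable [IsManifold I ∞ M]

/-- `X` is a smooth vector field on `M`, that is, an element of `Γ(TM)`. -/
def IsSmoothVectorField (X : (x : M) → TangentSpace I x) : Prop :=
  ContMDiff I I.tangent ∞ (fun x => (⟨x, X x⟩ : TangentBundle I M))

/-- A smooth tensor field of type `(1,1)` on `M`. -/
def IsSmoothEndomorphismField (J : (x : M) → TangentSpace I x →L[ℝ] TangentSpace I x) : Prop :=
  ContMDiff I (I.prod 𝓘(ℝ, E →L[ℝ] E)) ∞
    (fun x => (TotalSpace.mk' (E →L[ℝ] E) x (J x) :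
      TotalSpace (E →L[ℝ] E) (fun x : M => TangentSpace I x →L[ℝ] TangentSpace I x)))

/-- A metallic Riemannian structure on the Riemannian manifold `M`: a smooth `(1,1)`-tensor field
`J` with `J² = pJ + qI` that is symmetric for the metric. -/
structure IsMetallicStructure [RiemannianBundle (fun x : M => TangentSpace I x)] (p q : ℕ)
    (J : (x : M) → TangentSpace I x →L[ℝ] TangentSpace I x) : Prop where
  smooth : IsSmoothEndomorphismField I J
  sq_eq : ∀ (x : M) (u : TangentSpace I x), J x (J x u) = (p : ℝ) • J x u + (q : ℝ) • u
  compatible : ∀ (x : M) (u v : TangentSpace I x), inner ℝ (J x u) v = inner ℝ u (J x v)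

variable [FiniteDimensional ℝ E] [RiemannianBundle (fun x : M => TangentSpace I x)]
  [IsContMDiffRiemannianBundle I ∞ E (fun x : M => TangentSpace I x)]

/-- A connection on the tangent bundle of the Riemannian manifold `M` is the Levi-Civita
connection if it is torsion-free and compatible with the metric. -/
def IsLeviCivita [CompleteSpace E]
    (nabla : CovariantDerivative I E (fun x : M => TangentSpace I x)) : Prop :=
  (∀ x : M, nabla.torsion x = 0) ∧
    CovariantDerivative.IsMetricCompatible (F := E) (V := fun x : M => TangentSpace I x) nabla

/-- A locally metallic Riemannian structure: a metallic Riemannian structure `J` that is parallel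
for the Levi-Civita connection, `∇_v (J Y) = J (∇_v Y)` for all tangent vectors `v` and all
smooth vector fields `Y`. In Mathlib's notation `nabla Y x v` is `∇_v Y` at the point `x`. -/
def IsLocallyMetallic [CompleteSpace E] (p q : ℕ)
    (J : (x : M) → TangentSpace I x →L[ℝ] TangentSpace I x) : Prop :=
  IsMetallicStructure I p q J ∧
    ∃ nabla : CovariantDerivative I E (fun x : M => TangentSpace I x), IsLeviCivita I nabla ∧
      ∀ Y : (x : M) → TangentSpace I x, IsSmoothVectorField I Y →
        ∀ (x : M) (v : TangentSpace I x), nabla (fun y => J y (Y y)) x v = J x (nabla Y x v)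

end Ambient

section Submanifold

variable {E : Type*} [NormedAddCommGroup E] [NormedSpace ℝ E]
  {H : Type*} [TopologicalSpace H] (I : ModelWithCorners ℝ E H)
  {S : Type*} [TopologicalSpace S] [ChartedSpace H S]
  {E' : Type*} [NormedAddCommGroup E'] [NormedSpace ℝ E']
  {H' : Type*} [TopologicalSpace H'] (I' : ModelWithCorners ℝ E' H')
  {N : Type*} [TopologicalSpace N] [ChartedSpace H' N]

/-- The submanifold `j : S → N` is invariant: `J (T_x S) ⊆ T_x S` at every point, where `T_x S` is
regarded as a subspace of the ambient tangent space through the differential of `j`. -/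
def IsInvariantSubmanifold (J : (y : N) → TangentSpace I' y →L[ℝ] TangentSpace I' y)
    (j : S → N) : Prop :=
  ∀ (x : S) (u : TangentSpace I x),
    ∃ v : TangentSpace I x, J (j x) (mfderiv I I' j x u) = mfderiv I I' j x v

variable [FiniteDimensional ℝ E]
  [RiemannianBundle (fun y : N => TangentSpace I' y)]

/-- The image of `T_z S` in the ambient tangent space admits an orthogonal projection, being
finite-dimensional. -/
theorem hasOrthogonalProjection_tangent (i : S → N) (z : S) :
    (LinearMap.range (mfderiv I I' i z).toLinearMap).HasOrthogonalProjection := by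
  have : FiniteDimensional ℝ (TangentSpace I z) := inferInstanceAs (FiniteDimensional ℝ E)
  have : CompleteSpace (LinearMap.range (mfderiv I I' i z).toLinearMap) :=
    FiniteDimensional.complete ℝ _
  infer_instance

/-- The tangential part of an ambient vector `ξ` at `i z`: a vector of `T_z S` (the unique one if
`i` is an immersion) whose image is the orthogonal projection of `ξ` to the image of `T_z S`. -/
noncomputable def tangentialPart (i : S → N) (z : S) (ξ : TangentSpace I' (i z)) :
    TangentSpace I z :=
  have := hasOrthogonalProjection_tangent I I' i z
  Classical.choose (LinearMap.mem_range.mp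
    (Submodule.starProjection_apply_mem (LinearMap.range (mfderiv I I' i z).toLinearMap) ξ))

/-- The defining property of the tangential part: what remains of `ξ` is normal. -/
theorem inner_sub_tangentialPart (i : S → N) (z : S) (ξ : TangentSpace I' (i z))
    (w : TangentSpace I z) :
    inner ℝ (ξ - mfderiv I I' i z (tangentialPart I I' i z ξ)) (mfderiv I I' i z w) = 0 := by
  have := hasOrthogonalProjection_tangent I I' i z
  have h : mfderiv I I' i z (tangentialPart I I' i z ξ) =
      (LinearMap.range (mfderiv I I' i z).toLinearMap).starProjection ξ :=
    Classical.choose_spec (LinearMap.mem_range.mp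
      (Submodule.starProjection_apply_mem (LinearMap.range (mfderiv I I' i z).toLinearMap) ξ))
  rw [h]
  exact Submodule.starProjection_inner_eq_zero ξ _ (LinearMap.mem_range_self _ w)

/-- The field `TX = (J X)^T` on the submanifold `i : S → N`, for a vector field `X` on `S`. -/
noncomputable def tangentialField (J : (y : N) → TangentSpace I' y →L[ℝ] TangentSpace I' y)
    (i : S → N) (X : (z : S) → TangentSpace I z) (z : S) : TangentSpace I z :=
  tangentialPart I I' i z (J (i z) (mfderiv I I' i z (X z)))

end Submanifold

section Warped

variable {E₁ : Type*} [NormedAddCommGroup E₁] [NormedSpace ℝ E₁]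
  {H₁ : Type*} [TopologicalSpace H₁] (I₁ : ModelWithCorners ℝ E₁ H₁)
  {M₁ : Type*} [TopologicalSpace M₁] [ChartedSpace H₁ M₁]
  {E₂ : Type*} [NormedAddCommGroup E₂] [NormedSpace ℝ E₂]
  {H₂ : Type*} [TopologicalSpace H₂] (I₂ : ModelWithCorners ℝ E₂ H₂)
  {M₂ : Type*} [TopologicalSpace M₂] [ChartedSpace H₂ M₂]
  {E : Type*} [NormedAddCommGroup E] [NormedSpace ℝ E]
  {H : Type*} [TopologicalSpace H] (I : ModelWithCorners ℝ E H)
  {M : Type*} [TopologicalSpace M] [ChartedSpace H M]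

/-- The horizontal lift to `M₁ × M₂` of a vector field on `M₁`. -/
noncomputable def horizontalLift (X : (x : M₁) → TangentSpace I₁ x) (z : M₁ × M₂) :
    TangentSpace (I₁.prod I₂) z :=
  ContinuousLinearMap.inl ℝ (TangentSpace I₁ z.1) (TangentSpace I₂ z.2) (X z.1)

variable [IsManifold I₁ ∞ M₁] [IsManifold I₂ ∞ M₂] [IsManifold I ∞ M]
  [RiemannianBundle (fun x : M₁ => TangentSpace I₁ x)]
  [RiemannianBundle (fun x : M₂ => TangentSpace I₂ x)]
  [RiemannianBundle (fun x : M => TangentSpace I x)]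

/-- The warped product metric `π₁^* g₁ + (f ∘ π₁)² π₂^* g₂` on `M₁ × M₂`. -/
noncomputable def warpedMetric (f : M₁ → ℝ) (z : M₁ × M₂)
    (u v : TangentSpace (I₁.prod I₂) z) : ℝ :=
  inner ℝ (mfderiv (I₁.prod I₂) I₁ (Prod.fst : M₁ × M₂ → M₁) z u)
      (mfderiv (I₁.prod I₂) I₁ (Prod.fst : M₁ × M₂ → M₁) z v) +
    f z.1 ^ 2 *
      inner ℝ (mfderiv (I₁.prod I₂) I₂ (Prod.snd : M₁ × M₂ → M₂) z u)
        (mfderiv (I₁.prod I₂) I₂ (Prod.snd : M₁ × M₂ → M₂) z v)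

/-- `i` makes the warped product `M₁ ×_f M₂` an isometrically immersed submanifold of `M`: the
warping function `f` is smooth and positive, and `i` is a smooth map that pulls the metric of `M`
back to the warped product metric (so `i` is an immersion). -/
structure IsWarpedProductSubmanifold (f : M₁ → ℝ) (i : M₁ × M₂ → M) : Prop where
  smooth_warping : ContMDiff I₁ 𝓘(ℝ, ℝ) ∞ f
  warping_pos : ∀ x, 0 < f x
  smooth_map : ContMDiff (I₁.prod I₂) I ∞ i
  isometric : ∀ (z : M₁ × M₂) (u v : TangentSpace (I₁.prod I₂) z),
    inner ℝ (mfderiv (I₁.prod I₂) I i z u) (mfderiv (I₁.prod I₂) I i z v) =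
      warpedMetric I₁ I₂ f z u v

end Warped

section Frame

open VectorField Topology

variable {E : Type*} [NormedAddCommGroup E] [NormedSpace ℝ E] [FiniteDimensional ℝ E]
  {H : Type*} [TopologicalSpace H] (I : ModelWithCorners ℝ E H)
  {M : Type*} [TopologicalSpace M] [ChartedSpace H M] [IsManifold I ∞ M]

/-- The coordinate vector field of the chart at `y₀` in the direction `a`. -/
noncomputable def coordinateField (y₀ : M) (a : E) : (y : M) → TangentSpace I y :=
  mpullback I 𝓘(ℝ, E) (extChartAt I y₀) (fun _ => a)

omit [FiniteDimensional ℝ E] [IsManifold I ∞ M] in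
theorem coordinateField_apply (y₀ : M) (a : E) (y : M) :
    coordinateField I y₀ a y = (mfderiv I 𝓘(ℝ, E) (extChartAt I y₀) y).inverse a := rfl

theorem contMDiffAt_coordinateField (y₀ : M) (a : E) {y : M} (hy : y ∈ (chartAt H y₀).source) :
    ContMDiffAt I I.tangent ∞
      (fun x => (⟨x, coordinateField I y₀ a x⟩ : TangentBundle I M)) y := by
  have : CompleteSpace E := FiniteDimensional.complete ℝ E
  refine ContMDiffAt.mpullback_vectorField_preimage (n := ∞) ?_ (contMDiffAt_extChartAt' hy)
    (isInvertible_mfderiv_extChartAt (by simpa using hy)) (by simp)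
  exact contMDiffAt_vectorSpace_iff_contDiffAt.2 contDiffAt_const

theorem mlieBracket_coordinateField (y₀ : M) (a b : E) :
    mlieBracket I (coordinateField I y₀ a) (coordinateField I y₀ b) y₀ = 0 := by
  have : CompleteSpace E := FiniteDimensional.complete ℝ E
  have : IsManifold I (minSmoothness ℝ 2) M := by
    simpa using IsManifold.of_le (I := I) (M := M) (n := ∞) (m := 2)
      (WithTop.coe_le_coe.2 (le_top : (2 : ℕ∞) ≤ ⊤))
  have hc (c : E) : MDifferentiableAt 𝓘(ℝ, E) 𝓘(ℝ, E).tangent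
      (fun x => (⟨x, c⟩ : TangentBundle 𝓘(ℝ, E) E)) (extChartAt I y₀ y₀) :=
    ContMDiffAt.mdifferentiableAt (n := ∞)
      (contMDiffAt_vectorSpace_iff_contDiffAt.2 contDiffAt_const) (by simp)
  have := mpullback_mlieBracket (I := I) (I' := 𝓘(ℝ, E)) (n := ∞) (f := extChartAt I y₀)
    (V := fun _ => a) (W := fun _ => b) (x₀ := y₀) (hc a) (hc b) contMDiffAt_extChartAt
    (by simpa using WithTop.coe_le_coe.2 (le_top : (2 : ℕ∞) ≤ ⊤))
  refine this.symm.trans ?_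
  have h0 : mlieBracket 𝓘(ℝ, E) (fun _ : E => a) (fun _ : E => b) (extChartAt I y₀ y₀) = 0 := by
    rw [mlieBracketWithin_univ.symm.trans (mlieBracketWithin_eq_lieBracketWithin (V := fun _ => a)
      (W := fun _ => b))]
    simp [lieBracketWithin]
    rfl
  rw [mpullback_apply, h0, map_zero]

/-- Coordinate vector fields agree near the base point of the chart with globally smooth fields. -/
theorem exists_smooth_eventuallyEq_coordinateField [T2Space M] (y₀ : M) (a : E) :
    ∃ Y : (y : M) → TangentSpace I y, IsSmoothVectorField I Y ∧
      ∀ᶠ y in 𝓝 y₀, Y y = coordinateField I y₀ a y := by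
  obtain ⟨ρ⟩ : Nonempty (SmoothBumpFunction I y₀) := inferInstance
  refine ⟨(ρ : M → ℝ) • coordinateField I y₀ a, ?_, ?_⟩
  · exact ContMDiffOn.smul_section_of_tsupport ρ.contMDiff.contMDiffOn (chartAt H y₀).open_source
      ρ.tsupport_subset_chartAt_source
      (fun y hy => (contMDiffAt_coordinateField I y₀ a hy).contMDiffWithinAt)
  · filter_upwards [ρ.eventuallyEq_one] with y hy
    simp [hy]

omit [FiniteDimensional ℝ E] [IsManifold I ∞ M] in
theorem IsSmoothVectorField.mdifferentiableAt [IsManifold I ∞ M] {Y : (y : M) → TangentSpace I y}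
    (hY : IsSmoothVectorField I Y) (y : M) :
    MDifferentiableAt I I.tangent (fun x => (⟨x, Y x⟩ : TangentBundle I M)) y :=
  (ContMDiff.contMDiffAt hY).mdifferentiableAt (by simp)

end Frame

section Parallel

open Topology

variable {E : Type*} [NormedAddCommGroup E] [NormedSpace ℝ E] [FiniteDimensional ℝ E]
  {H : Type*} [TopologicalSpace H] (I : ModelWithCorners ℝ E H)
  {M : Type*} [TopologicalSpace M] [ChartedSpace H M] [IsManifold I ∞ M]

/-- The field `β` of bilinear forms is parallel for the connection `nabla`. -/
def IsParallelForm (nabla : CovariantDerivative I E (fun x : M => TangentSpace I x))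
    (β : (y : M) → TangentSpace I y → TangentSpace I y → ℝ) : Prop :=
  ∀ Y Z : (y : M) → TangentSpace I y, IsSmoothVectorField I Y → IsSmoothVectorField I Z →
    ∀ y : M, MDifferentiableAt I 𝓘(ℝ, ℝ) (fun x => β x (Y x) (Z x)) y ∧
      ∀ v : TangentSpace I y, mfderiv I 𝓘(ℝ, ℝ) (fun x => β x (Y x) (Z x)) y v =
        β y (nabla Y y v) (Z y) + β y (Y y) (nabla Z y v)

omit [FiniteDimensional ℝ E] in
theorem IsSmoothEndomorphismField.apply {J : (x : M) → TangentSpace I x →L[ℝ] TangentSpace I x}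
    (hJ : IsSmoothEndomorphismField I J) {Y : (y : M) → TangentSpace I y}
    (hY : IsSmoothVectorField I Y) : IsSmoothVectorField I (fun y => J y (Y y)) := fun y =>
  ContMDiffAt.clm_bundle_apply (F₁ := E) (F₂ := E) (hJ y) (hY y)

variable [RiemannianBundle (fun x : M => TangentSpace I x)]
  [IsContMDiffRiemannianBundle I ∞ E (fun x : M => TangentSpace I x)] [CompleteSpace E]

theorem IsLeviCivita.mfderiv_inner
    {nabla : CovariantDerivative I E (fun x : M => TangentSpace I x)} (h : IsLeviCivita I nabla)
    {Y Z : (y : M) → TangentSpace I y} (hY : IsSmoothVectorField I Y)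
    (hZ : IsSmoothVectorField I Z) (y : M) (v : TangentSpace I y) :
    mfderiv I 𝓘(ℝ, ℝ) (fun x => (inner ℝ (Y x) (Z x) : ℝ)) y v =
        inner ℝ (nabla Y y v) (Z y) + inner ℝ (Y y) (nabla Z y v) := by
  classical
  have := h.2.mvfderiv_inner_eq (fun x => if hx : x = y then hx ▸ v else 0)
    (hY.mdifferentiableAt I y) (hZ.mdifferentiableAt I y)
  simpa using! this

theorem IsLeviCivita.isParallelForm_inner
    {nabla : CovariantDerivative I E (fun x : M => TangentSpace I x)} (h : IsLeviCivita I nabla) :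
    IsParallelForm I nabla (fun _ u v => inner ℝ u v) := fun _ _ hY hZ y =>
  ⟨MDifferentiableAt.inner_bundle (E := fun x : M => TangentSpace I x) (F := E)
    (hY.mdifferentiableAt I y) (hZ.mdifferentiableAt I y), h.mfderiv_inner I hY hZ y⟩

theorem IsLeviCivita.isParallelForm_inner_apply
    {nabla : CovariantDerivative I E (fun x : M => TangentSpace I x)} (h : IsLeviCivita I nabla)
    {J : (x : M) → TangentSpace I x →L[ℝ] TangentSpace I x} (hJ : IsSmoothEndomorphismField I J)
    (hJ' : ∀ Y : (x : M) → TangentSpace I x, IsSmoothVectorField I Y →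
        ∀ (x : M) (v : TangentSpace I x), nabla (fun y => J y (Y y)) x v = J x (nabla Y x v)) :
    IsParallelForm I nabla (fun y u v => inner ℝ (J y u) v) := fun _ _ hY hZ y =>
  ⟨MDifferentiableAt.inner_bundle (E := fun x : M => TangentSpace I x) (F := E)
    ((hJ.apply I hY).mdifferentiableAt I y) (hZ.mdifferentiableAt I y), fun v => by
    rw [h.mfderiv_inner I (hJ.apply I hY) hZ, hJ' _ hY]⟩

theorem IsLeviCivita.apply_comm_of_coordinateField
    {nabla : CovariantDerivative I E (fun x : M => TangentSpace I x)} (h : IsLeviCivita I nabla)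
    {Y Z : (y : M) → TangentSpace I y} (hY : IsSmoothVectorField I Y)
    (hZ : IsSmoothVectorField I Z) {y₀ : M} {a b : E}
    (ha : ∀ᶠ y in 𝓝 y₀, Y y = coordinateField I y₀ a y)
    (hb : ∀ᶠ y in 𝓝 y₀, Z y = coordinateField I y₀ b y) :
    nabla Y y₀ (Z y₀) = nabla Z y₀ (Y y₀) := by
  have h1 := nabla.torsion_apply (hZ.mdifferentiableAt I y₀) (hY.mdifferentiableAt I y₀)
  rw [h.1, Filter.EventuallyEq.mlieBracket_vectorField_eq hb ha, mlieBracket_coordinateField] at h1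
  simpa [sub_eq_zero] using h1.symm

end Parallel

section PullbackConnection

open Topology Module

variable {E : Type*} [NormedAddCommGroup E] [NormedSpace ℝ E] [FiniteDimensional ℝ E]
  {H : Type*} [TopologicalSpace H] (I : ModelWithCorners ℝ E H)
  {M : Type*} [TopologicalSpace M] [ChartedSpace H M] [IsManifold I ∞ M]
  {W : Type*} [NormedAddCommGroup W] [NormedSpace ℝ W]

omit [FiniteDimensional ℝ E] in
/-- The derivative of a map in the coordinates of a chart, expressed by coordinate fields. -/
theorem mfderiv_eq_coordinateField {h : W → M} {y₀ : M} {w : W}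
    (hs : h w ∈ (chartAt H y₀).source) (hd : MDifferentiableAt 𝓘(ℝ, W) I h w) (a : W) :
    mfderiv 𝓘(ℝ, W) I h w a =
      coordinateField I y₀ (fderiv ℝ (fun w => extChartAt I y₀ (h w)) w a) (h w) := by
  have hφ : MDifferentiableAt I 𝓘(ℝ, E) (extChartAt I y₀) (h w) := mdifferentiableAt_extChartAt hs
  have h1 := mfderiv_comp w hφ hd
  have h2 : fderiv ℝ (fun w => extChartAt I y₀ (h w)) w a =
      mfderiv I 𝓘(ℝ, E) (extChartAt I y₀) (h w) (mfderiv 𝓘(ℝ, W) I h w a) := by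
    rw [← mfderiv_eq_fderiv]
    exact DFunLike.congr_fun h1 a
  refine Eq.trans ?_ (congrArg (fun v => coordinateField I y₀ v (h w)) h2).symm
  exact ((isInvertible_mfderiv_extChartAt (by simpa using hs)).inverse_apply_eq.2 rfl).symm

omit [FiniteDimensional ℝ E] [IsManifold I ∞ M] in
theorem coordinateField_eq_sum {ι : Type*} [Fintype ι] (b : Basis ι ℝ E) (y₀ : M) (a : E) (y : M) :
    coordinateField I y₀ a y = ∑ j, b.repr a j • coordinateField I y₀ (b j) y := by
  have : coordinateField I y₀ a y = coordinateField I y₀ (∑ j, b.repr a j • b j) y := by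
    rw [b.sum_repr]
  rw [this]
  simp only [coordinateField_apply]
  exact (map_sum _ _ _).trans (Finset.sum_congr rfl fun j _ => map_smul _ _ _)

variable [T2Space M] [RiemannianBundle (fun x : M => TangentSpace I x)]
  [IsContMDiffRiemannianBundle I ∞ E (fun x : M => TangentSpace I x)] [CompleteSpace E]

/-- The second covariant derivative `B` of a smooth map `h` into a Riemannian manifold: it is
symmetric, and it computes the derivative of the pull-back of any parallel bilinear form. -/
theorem IsLeviCivita.exists_hessian
    {nabla : CovariantDerivative I E (fun x : M => TangentSpace I x)} (hn : IsLeviCivita I nabla)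
    {h : W → M} {w₀ : W} (hh : ContMDiffAt 𝓘(ℝ, W) I ∞ h w₀) :
    ∃ B : W → W → TangentSpace I (h w₀), (∀ a b, B a b = B b a) ∧
      ∀ β : (y : M) → TangentSpace I y →ₗ[ℝ] TangentSpace I y →ₗ[ℝ] ℝ,
        IsParallelForm I nabla (fun y u v => β y u v) → ∀ a b : W,
        DifferentiableAt ℝ
          (fun w => β (h w) (mfderiv 𝓘(ℝ, W) I h w a) (mfderiv 𝓘(ℝ, W) I h w b)) w₀ ∧
        ∀ c : W, fderiv ℝ
          (fun w => β (h w) (mfderiv 𝓘(ℝ, W) I h w a) (mfderiv 𝓘(ℝ, W) I h w b)) w₀ c =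
          β (h w₀) (B c a) (mfderiv 𝓘(ℝ, W) I h w₀ b) +
            β (h w₀) (mfderiv 𝓘(ℝ, W) I h w₀ a) (B c b) := by
  set y₀ := h w₀ with hy₀
  let bas := finBasis ℝ E
  choose Y hY hYe using fun j => exists_smooth_eventuallyEq_coordinateField I y₀ (bas j)
  let k : W → E := fun w => extChartAt I y₀ (h w)
  have hk : ContDiffAt ℝ ∞ k w₀ :=
    contMDiffAt_iff_contDiffAt.1 (contMDiffAt_extChartAt.comp w₀ hh)
  have hk2 : ContDiffAt ℝ 2 k w₀ := hk.of_le (WithTop.coe_le_coe.2 le_top)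
  let A : W → Fin (finrank ℝ E) → W → ℝ := fun a j w => bas.repr (fderiv ℝ k w a) j
  have hL : ∀ᶠ w in 𝓝 w₀, ∀ a : W, mfderiv 𝓘(ℝ, W) I h w a = ∑ j, A a j w • Y j (h w) := by
    have e1 : ∀ᶠ w in 𝓝 w₀, h w ∈ (chartAt H y₀).source :=
      hh.continuousAt.eventually ((chartAt H y₀).open_source.mem_nhds (mem_chart_source H y₀))
    have e2 : ∀ᶠ w in 𝓝 w₀, MDifferentiableAt 𝓘(ℝ, W) I h w := by
      have h1 : ContMDiffAt 𝓘(ℝ, W) I 1 h w₀ := hh.of_le (WithTop.coe_le_coe.2 le_top)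
      filter_upwards [(contMDiffAt_iff_contMDiffAt_nhds (by simp)).1 h1] with w hw using hw.mdifferentiableAt (by simp)
    have e3 : ∀ᶠ w in 𝓝 w₀, ∀ j, Y j (h w) = coordinateField I y₀ (bas j) (h w) :=
      Filter.eventually_all.2 fun j => hh.continuousAt.eventually (hYe j)
    filter_upwards [e1, e2, e3] with w h1 h2 h3 a
    rw [mfderiv_eq_coordinateField I h1 h2, coordinateField_eq_sum I bas]
    exact Finset.sum_congr rfl fun j _ => by rw [h3]
  let L : W → TangentSpace I y₀ := fun a => mfderiv 𝓘(ℝ, W) I h w₀ a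
  have hL₀ : ∀ a, L a = ∑ j, A a j w₀ • Y j y₀ := hL.self_of_nhds
  have hA : ∀ a j, HasFDerivAt (A a j)
      (((bas.coord j).toContinuousLinearMap).comp ((fderiv ℝ (fderiv ℝ k) w₀).flip a)) w₀ := by
    intro a j
    have h1 : HasFDerivAt (fderiv ℝ k) (fderiv ℝ (fderiv ℝ k) w₀) w₀ :=
      ((hk2.fderiv_right (m := 1) (by norm_num)).differentiableAt (by simp)).hasFDerivAt
    have h2 : HasFDerivAt (fun w => fderiv ℝ k w a) ((fderiv ℝ (fderiv ℝ k) w₀).flip a) w₀ := by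
      simpa using h1.clm_apply (hasFDerivAt_const a w₀)
    exact (bas.coord j).toContinuousLinearMap.hasFDerivAt.comp w₀ h2
  let A' : W → W → Fin (finrank ℝ E) → ℝ := fun c a j =>
    bas.repr (fderiv ℝ (fderiv ℝ k) w₀ c a) j
  let B : W → W → TangentSpace I y₀ := fun c a =>
    ∑ j, (A' c a j • Y j y₀ + A a j w₀ • nabla (Y j) y₀ (L c))
  have hA'symm : ∀ c a j, A' c a j = A' a c j := by
    intro c a j
    have := (hk2.isSymmSndFDerivAt (by simp)).eq c a
    simp only [A', this]
  have hYsymm : ∀ j l, nabla (Y j) y₀ (Y l y₀) = nabla (Y l) y₀ (Y j y₀) := fun j l =>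
    hn.apply_comm_of_coordinateField I (hY j) (hY l) (hYe j) (hYe l)
  refine ⟨B, ?_, ?_⟩
  · intro a b
    simp only [B, Finset.sum_add_distrib]
    congr 1
    · exact Finset.sum_congr rfl fun j _ => by rw [hA'symm]
    · simp only [hL₀, map_sum, map_smul, Finset.smul_sum]
      rw [Finset.sum_comm]
      refine Finset.sum_congr rfl fun j _ => Finset.sum_congr rfl fun l _ => ?_
      rw [hYsymm, smul_comm]
  · intro β hβ a b
    let m : Fin (finrank ℝ E) → Fin (finrank ℝ E) → M → ℝ := fun j l y => β y (Y j y) (Y l y)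
    have hm : ∀ j l, HasFDerivAt (fun w => m j l (h w))
        (fderiv ℝ (fun w => m j l (h w)) w₀) w₀ := fun j l =>
      (((hβ _ _ (hY j) (hY l) y₀).1.comp w₀
        (hh.mdifferentiableAt (by simp))).differentiableAt).hasFDerivAt
    have hm' : ∀ j l c, fderiv ℝ (fun w => m j l (h w)) w₀ c =
        β y₀ (nabla (Y j) y₀ (L c)) (Y l y₀) + β y₀ (Y j y₀) (nabla (Y l) y₀ (L c)) := by
      intro j l c
      rw [← (hβ _ _ (hY j) (hY l) y₀).2, ← mfderiv_eq_fderiv]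
      have := mfderiv_comp w₀ (hβ _ _ (hY j) (hY l) y₀).1 (hh.mdifferentiableAt (by simp))
      exact DFunLike.congr_fun this c
    have hev : (fun w => β (h w) (mfderiv 𝓘(ℝ, W) I h w a) (mfderiv 𝓘(ℝ, W) I h w b)) =ᶠ[𝓝 w₀]
        fun w => ∑ j, ∑ l, A a j w * (A b l w * m j l (h w)) := by
      filter_upwards [hL] with w hw
      rw [hw, hw]
      simp only [map_sum, map_smul, LinearMap.sum_apply, LinearMap.smul_apply, smul_eq_mul, m,
        Finset.mul_sum]
      rw [Finset.sum_comm]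
      refine Finset.sum_congr rfl fun j _ => Finset.sum_congr rfl fun l _ => ?_
      ring
    have hder := (HasFDerivAt.fun_sum (u := Finset.univ) fun j _ =>
      HasFDerivAt.fun_sum (u := Finset.univ) fun l _ =>
        (hA a j).mul ((hA b l).mul (hm j l))).congr_of_eventuallyEq hev
    refine ⟨hder.differentiableAt, fun c => ?_⟩
    rw [hder.fderiv]
    change _ = β y₀ (B c a) (L b) + β y₀ (L a) (B c b)
    have hsum : ∀ u v : Fin (finrank ℝ E) → TangentSpace I y₀,
        β y₀ (∑ j, u j) (∑ l, v l) = ∑ j, ∑ l, β y₀ (u j) (v l) := fun u v => by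
      simp only [map_sum, LinearMap.sum_apply]
      exact Finset.sum_comm
    rw [hL₀ a, hL₀ b, hsum, hsum, ← Finset.sum_add_distrib]
    rw [sum_apply]
    refine Finset.sum_congr rfl fun j _ => ?_
    rw [sum_apply, ← Finset.sum_add_distrib]
    refine Finset.sum_congr rfl fun l _ => ?_
    have hA'' : ∀ a j, ((bas.coord j).toContinuousLinearMap.comp
        ((fderiv ℝ (fderiv ℝ k) w₀).flip a)) c = A' c a j := fun _ _ => rfl
    simp only [map_add, map_smul, LinearMap.add_apply, LinearMap.smul_apply, smul_eq_mul,
      add_apply, smul_apply, hA'', hm']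
    simp only [m, Pi.mul_apply, ← hy₀]
    ring

end PullbackConnection

section WarpedSubmanifold

open Topology

variable {E₁ : Type*} [NormedAddCommGroup E₁] [NormedSpace ℝ E₁]
  {H₁ : Type*} [TopologicalSpace H₁] {I₁ : ModelWithCorners ℝ E₁ H₁}
  {M₁ : Type*} [TopologicalSpace M₁] [ChartedSpace H₁ M₁]
  {E₂ : Type*} [NormedAddCommGroup E₂] [NormedSpace ℝ E₂]
  {H₂ : Type*} [TopologicalSpace H₂] {I₂ : ModelWithCorners ℝ E₂ H₂}
  {M₂ : Type*} [TopologicalSpace M₂] [ChartedSpace H₂ M₂]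
  {E : Type*} [NormedAddCommGroup E] [NormedSpace ℝ E]
  {H : Type*} [TopologicalSpace H] {I : ModelWithCorners ℝ E H}
  {M : Type*} [TopologicalSpace M] [ChartedSpace H M]

variable (I₁ I₂ I) in
/-- The differential of `i` on a horizontal tangent vector. -/
noncomputable def horizontalMap (i : M₁ × M₂ → M) (z : M₁ × M₂) :
    TangentSpace I₁ z.1 →L[ℝ] TangentSpace I (i z) :=
  (mfderiv (I₁.prod I₂) I i z).comp
    (ContinuousLinearMap.inl ℝ (TangentSpace I₁ z.1) (TangentSpace I₂ z.2))

variable (I₁ I₂ I) in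
/-- The differential of `i` on a vertical tangent vector. -/
noncomputable def verticalMap (i : M₁ × M₂ → M) (z : M₁ × M₂) :
    TangentSpace I₂ z.2 →L[ℝ] TangentSpace I (i z) :=
  (mfderiv (I₁.prod I₂) I i z).comp
    (ContinuousLinearMap.inr ℝ (TangentSpace I₁ z.1) (TangentSpace I₂ z.2))

theorem mfderiv_eq_horizontalMap_add_verticalMap (i : M₁ × M₂ → M) (z : M₁ × M₂)
    (x : TangentSpace I₁ z.1) (u : TangentSpace I₂ z.2) :
    mfderiv (I₁.prod I₂) I i z (x, u) =
      horizontalMap I₁ I₂ I i z x + verticalMap I₁ I₂ I i z u := by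
  have : ((x, u) : TangentSpace I₁ z.1 × TangentSpace I₂ z.2) =
    ContinuousLinearMap.inl ℝ (TangentSpace I₁ z.1) (TangentSpace I₂ z.2) x +
      ContinuousLinearMap.inr ℝ (TangentSpace I₁ z.1) (TangentSpace I₂ z.2) u := by simp
  refine (congrArg (mfderiv (I₁.prod I₂) I i z) this).trans (map_add _ _ _)

theorem mfderiv_slice_left {i : M₁ × M₂ → M} {z : M₁ × M₂}
    (hi : MDifferentiableAt (I₁.prod I₂) I i z) (x : TangentSpace I₁ z.1) :
    mfderiv I₁ I (fun x => i (x, z.2)) z.1 x = horizontalMap I₁ I₂ I i z x := by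
  have h1 := mfderiv_comp (I := I₁) (I' := I₁.prod I₂) (I'' := I) z.1 (g := i)
    (f := fun x => (x, z.2)) hi (mdifferentiableAt_id.prodMk mdifferentiableAt_const)
  rw [mfderiv_prod_left] at h1
  exact DFunLike.congr_fun h1 x

theorem mfderiv_slice_right {i : M₁ × M₂ → M} {z : M₁ × M₂}
    (hi : MDifferentiableAt (I₁.prod I₂) I i z) (u : TangentSpace I₂ z.2) :
    mfderiv I₂ I (fun y => i (z.1, y)) z.2 u = verticalMap I₁ I₂ I i z u := by
  have h1 := mfderiv_comp (I := I₂) (I' := I₁.prod I₂) (I'' := I) z.2 (g := i)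
    (f := fun y => (z.1, y)) hi (mdifferentiableAt_const.prodMk mdifferentiableAt_id)
  rw [mfderiv_prod_right] at h1
  exact DFunLike.congr_fun h1 u

theorem mfderiv_comp_prod {i : M₁ × M₂ → M} {s₁ : E₁ → M₁} {s₂ : E₂ → M₂} {w : E₁ × E₂}
    (hi : MDifferentiableAt (I₁.prod I₂) I i (s₁ w.1, s₂ w.2))
    (h₁ : MDifferentiableAt 𝓘(ℝ, E₁) I₁ s₁ w.1) (h₂ : MDifferentiableAt 𝓘(ℝ, E₂) I₂ s₂ w.2)
    (a : E₁) (b : E₂) :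
    mfderiv 𝓘(ℝ, E₁ × E₂) I (fun w : E₁ × E₂ => i (s₁ w.1, s₂ w.2)) w (a, b) =
      horizontalMap I₁ I₂ I i (s₁ w.1, s₂ w.2) (mfderiv 𝓘(ℝ, E₁) I₁ s₁ w.1 a) +
        verticalMap I₁ I₂ I i (s₁ w.1, s₂ w.2) (mfderiv 𝓘(ℝ, E₂) I₂ s₂ w.2 b) := by
  have hf : HasMFDerivAt 𝓘(ℝ, E₁ × E₂) 𝓘(ℝ, E₁) (Prod.fst : E₁ × E₂ → E₁) w
    (ContinuousLinearMap.fst ℝ E₁ E₂) := hasFDerivAt_fst.hasMFDerivAt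
  have hs : HasMFDerivAt 𝓘(ℝ, E₁ × E₂) 𝓘(ℝ, E₂) (Prod.snd : E₁ × E₂ → E₂) w
    (ContinuousLinearMap.snd ℝ E₁ E₂) := hasFDerivAt_snd.hasMFDerivAt
  have h := HasMFDerivAt.comp w hi.hasMFDerivAt
    ((h₁.hasMFDerivAt.comp w hf).prodMk (h₂.hasMFDerivAt.comp w hs))
  rw [← mfderiv_eq_horizontalMap_add_verticalMap]
  exact DFunLike.congr_fun h.mfderiv (a, b)

variable (I₁) in
/-- The derivative of `ln f` along a tangent vector. -/
noncomputable def logDifferential (f : M₁ → ℝ) (x : M₁) (v : TangentSpace I₁ x) : ℝ :=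
  mfderiv I₁ 𝓘(ℝ, ℝ) (fun x => Real.log (f x)) x v

theorem ContMDiffAt.eventually_mdifferentiableAt [IsManifold I₁ ∞ M₁] {s : E₁ → M₁} {w : E₁}
    (hs : ContMDiffAt 𝓘(ℝ, E₁) I₁ ∞ s w) :
    ∀ᶠ t in 𝓝 w, MDifferentiableAt 𝓘(ℝ, E₁) I₁ s t := by
  have h1 : ContMDiffAt 𝓘(ℝ, E₁) I₁ 1 s w := hs.of_le (WithTop.coe_le_coe.2 le_top)
  have : IsManifold I₁ 1 M₁ := IsManifold.of_le (n := ∞) (WithTop.coe_le_coe.2 le_top)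
  filter_upwards [(contMDiffAt_iff_contMDiffAt_nhds (by simp)).1 h1] with t ht
    using ht.mdifferentiableAt (by simp)

variable [RiemannianBundle (fun x : M₁ => TangentSpace I₁ x)]
  [RiemannianBundle (fun x : M₂ => TangentSpace I₂ x)]
  [RiemannianBundle (fun x : M => TangentSpace I x)]
  {f : M₁ → ℝ} {i : M₁ × M₂ → M}

namespace IsWarpedProductSubmanifold

theorem inner_horizontalMap (hi : IsWarpedProductSubmanifold I₁ I₂ I f i)
    (z : M₁ × M₂) (x y : TangentSpace I₁ z.1) :
    inner ℝ (horizontalMap I₁ I₂ I i z x) (horizontalMap I₁ I₂ I i z y) = inner ℝ x y := by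
  refine (hi.isometric z _ _).trans ?_
  rw [warpedMetric, mfderiv_fst, mfderiv_snd]
  change inner ℝ x y + f z.1 ^ 2 * inner ℝ (0 : TangentSpace I₂ z.2) (0 : TangentSpace I₂ z.2) = _
  rw [inner_zero_left, mul_zero, add_zero]

theorem inner_horizontalMap_verticalMap (hi : IsWarpedProductSubmanifold I₁ I₂ I f i)
    (z : M₁ × M₂) (x : TangentSpace I₁ z.1) (u : TangentSpace I₂ z.2) :
    inner ℝ (horizontalMap I₁ I₂ I i z x) (verticalMap I₁ I₂ I i z u) = 0 := by
  refine (hi.isometric z _ _).trans ?_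
  rw [warpedMetric, mfderiv_fst, mfderiv_snd]
  change inner ℝ x (0 : TangentSpace I₁ z.1) + f z.1 ^ 2 * inner ℝ (0 : TangentSpace I₂ z.2) u = _
  rw [inner_zero_left, inner_zero_right, mul_zero, add_zero]

theorem inner_verticalMap (hi : IsWarpedProductSubmanifold I₁ I₂ I f i)
    (z : M₁ × M₂) (u v : TangentSpace I₂ z.2) :
    inner ℝ (verticalMap I₁ I₂ I i z u) (verticalMap I₁ I₂ I i z v) =
      f z.1 ^ 2 * inner ℝ u v := by
  refine (hi.isometric z _ _).trans ?_
  rw [warpedMetric, mfderiv_fst, mfderiv_snd]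
  change inner ℝ (0 : TangentSpace I₁ z.1) (0 : TangentSpace I₁ z.1) + f z.1 ^ 2 * inner ℝ u v = _
  rw [inner_zero_left, zero_add]

theorem mdifferentiableAt_map (hi : IsWarpedProductSubmanifold I₁ I₂ I f i) (z : M₁ × M₂) :
    MDifferentiableAt (I₁.prod I₂) I i z := hi.smooth_map.mdifferentiable (by simp) z

theorem mdifferentiableAt_log (hi : IsWarpedProductSubmanifold I₁ I₂ I f i) (x : M₁) :
    MDifferentiableAt I₁ 𝓘(ℝ, ℝ) (fun x => Real.log (f x)) x :=
  ((Real.differentiableAt_log (hi.warping_pos x).ne').mdifferentiableAt).comp x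
    (hi.smooth_warping.mdifferentiable (by simp) x)

theorem derivAlong_log (hi : IsWarpedProductSubmanifold I₁ I₂ I f i)
    (X : (z : M₁ × M₂) → TangentSpace (I₁.prod I₂) z) (z : M₁ × M₂) :
    derivAlong (I₁.prod I₂) X (fun w : M₁ × M₂ => Real.log (f w.1)) z =
      logDifferential I₁ f z.1 (X z).1 := by
  have h := HasMFDerivAt.comp z (hi.mdifferentiableAt_log z.1).hasMFDerivAt
    (hasMFDerivAt_fst (I := I₁) (I' := I₂) z)
  exact DFunLike.congr_fun h.mfderiv (X z)

variable [FiniteDimensional ℝ E₁] [FiniteDimensional ℝ E₂] in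
theorem tangentialPart_horizontalMap (hi : IsWarpedProductSubmanifold I₁ I₂ I f i)
    (z : M₁ × M₂) (x : TangentSpace I₁ z.1) :
    (tangentialPart (I₁.prod I₂) I i z (horizontalMap I₁ I₂ I i z x)).1 = x := by
  obtain ⟨t, u, htu⟩ : ∃ (t : TangentSpace I₁ z.1) (u : TangentSpace I₂ z.2),
      tangentialPart (I₁.prod I₂) I i z (horizontalMap I₁ I₂ I i z x) = (t, u) := ⟨_, _, rfl⟩
  have h := inner_sub_tangentialPart (I₁.prod I₂) I i z (horizontalMap I₁ I₂ I i z x)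
    (ContinuousLinearMap.inl ℝ (TangentSpace I₁ z.1) (TangentSpace I₂ z.2) (x - t))
  rw [htu] at h
  replace h : inner ℝ (horizontalMap I₁ I₂ I i z x - (horizontalMap I₁ I₂ I i z t +
      verticalMap I₁ I₂ I i z u)) (horizontalMap I₁ I₂ I i z (x - t)) = 0 := by
    rw [← mfderiv_eq_horizontalMap_add_verticalMap]
    exact h
  rw [← sub_sub, ← map_sub, inner_sub_left, hi.inner_horizontalMap,
    real_inner_comm (horizontalMap I₁ I₂ I i z (x - t)),
    hi.inner_horizontalMap_verticalMap, sub_zero, inner_self_eq_zero, sub_eq_zero] at h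
  rw [htu, h]

end IsWarpedProductSubmanifold

variable {J : (x : M) → TangentSpace I x →L[ℝ] TangentSpace I x}

theorem contMDiffAt_comp_prod {s₁ : E₁ → M₁} {s₂ : E₂ → M₂} {w : E₁ × E₂}
    (hi : IsWarpedProductSubmanifold I₁ I₂ I f i)
    (hs₁ : ContMDiffAt 𝓘(ℝ, E₁) I₁ ∞ s₁ w.1) (hs₂ : ContMDiffAt 𝓘(ℝ, E₂) I₂ ∞ s₂ w.2) :
    ContMDiffAt 𝓘(ℝ, E₁ × E₂) I ∞ (fun w : E₁ × E₂ => i (s₁ w.1, s₂ w.2)) w :=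
  (hi.smooth_map (s₁ w.1, s₂ w.2)).comp w
    ((hs₁.comp w contDiff_fst.contMDiff.contMDiffAt).prodMk
      (hs₂.comp w contDiff_snd.contMDiff.contMDiffAt))

theorem eventually_mfderiv_comp_prod [IsManifold I₁ ∞ M₁] [IsManifold I₂ ∞ M₂]
    {s₁ : E₁ → M₁} {s₂ : E₂ → M₂} {w : E₁ × E₂}
    (hi : IsWarpedProductSubmanifold I₁ I₂ I f i)
    (hs₁ : ContMDiffAt 𝓘(ℝ, E₁) I₁ ∞ s₁ w.1) (hs₂ : ContMDiffAt 𝓘(ℝ, E₂) I₂ ∞ s₂ w.2) :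
    ∀ᶠ t in 𝓝 w, ∀ (a : E₁) (b : E₂),
      mfderiv 𝓘(ℝ, E₁ × E₂) I (fun w : E₁ × E₂ => i (s₁ w.1, s₂ w.2)) t (a, b) =
      horizontalMap I₁ I₂ I i (s₁ t.1, s₂ t.2) (mfderiv 𝓘(ℝ, E₁) I₁ s₁ t.1 a) +
        verticalMap I₁ I₂ I i (s₁ t.1, s₂ t.2) (mfderiv 𝓘(ℝ, E₂) I₂ s₂ t.2 b) := by
  filter_upwards [continuousAt_fst.eventually hs₁.eventually_mdifferentiableAt,
    continuousAt_snd.eventually hs₂.eventually_mdifferentiableAt] with t h1 h2 a b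
  exact mfderiv_comp_prod (hi.mdifferentiableAt_map _) h1 h2 a b

theorem IsInvariantSubmanifold.exists_horizontalMap
    (hi : IsWarpedProductSubmanifold I₁ I₂ I f i) {z : M₁ × M₂}
    (h : IsInvariantSubmanifold I₁ I J (fun x : M₁ => i (x, z.2))) (x : TangentSpace I₁ z.1) :
    ∃ x', J (i z) (horizontalMap I₁ I₂ I i z x) = horizontalMap I₁ I₂ I i z x' := by
  obtain ⟨v, hv⟩ := h z.1 x
  refine ⟨v, ?_⟩
  rw [← mfderiv_slice_left (hi.mdifferentiableAt_map z),
    ← mfderiv_slice_left (hi.mdifferentiableAt_map z)]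
  exact hv

theorem IsInvariantSubmanifold.exists_verticalMap
    (hi : IsWarpedProductSubmanifold I₁ I₂ I f i) {z : M₁ × M₂}
    (h : IsInvariantSubmanifold I₂ I J (fun y : M₂ => i (z.1, y))) (u : TangentSpace I₂ z.2) :
    ∃ u', J (i z) (verticalMap I₁ I₂ I i z u) = verticalMap I₁ I₂ I i z u' := by
  obtain ⟨v, hv⟩ := h z.2 u
  refine ⟨v, ?_⟩
  rw [← mfderiv_slice_right (hi.mdifferentiableAt_map z),
    ← mfderiv_slice_right (hi.mdifferentiableAt_map z)]
  exact hv

end WarpedSubmanifold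

section MetallicWarped

open Topology

variable {E₁ : Type*} [NormedAddCommGroup E₁] [NormedSpace ℝ E₁]
  {H₁ : Type*} [TopologicalSpace H₁] {I₁ : ModelWithCorners ℝ E₁ H₁}
  {M₁ : Type*} [TopologicalSpace M₁] [ChartedSpace H₁ M₁] [IsManifold I₁ ∞ M₁]
  {E₂ : Type*} [NormedAddCommGroup E₂] [NormedSpace ℝ E₂]
  {H₂ : Type*} [TopologicalSpace H₂] {I₂ : ModelWithCorners ℝ E₂ H₂}
  {M₂ : Type*} [TopologicalSpace M₂] [ChartedSpace H₂ M₂] [IsManifold I₂ ∞ M₂]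
  {E : Type*} [NormedAddCommGroup E] [NormedSpace ℝ E] [FiniteDimensional ℝ E] [CompleteSpace E]
  {H : Type*} [TopologicalSpace H] {I : ModelWithCorners ℝ E H}
  {M : Type*} [TopologicalSpace M] [ChartedSpace H M] [IsManifold I ∞ M] [T2Space M]
  [RiemannianBundle (fun x : M₁ => TangentSpace I₁ x)]
  [RiemannianBundle (fun x : M₂ => TangentSpace I₂ x)]
  [RiemannianBundle (fun x : M => TangentSpace I x)]
  [IsContMDiffRiemannianBundle I ∞ E (fun x : M => TangentSpace I x)]
  {f : M₁ → ℝ} {i : M₁ × M₂ → M} {p q : ℕ}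
  {J : (x : M) → TangentSpace I x →L[ℝ] TangentSpace I x}

theorem log_warping_identity_of_parametrization (hJ : IsLocallyMetallic I p q J)
    (hi : IsWarpedProductSubmanifold I₁ I₂ I f i)
    (h₁ : ∀ y : M₂, IsInvariantSubmanifold I₁ I J (fun x : M₁ => i (x, y)))
    {s₁ : E₁ → M₁} {s₂ : E₂ → M₂} {w : E₁ × E₂}
    (hs₁ : ContMDiffAt 𝓘(ℝ, E₁) I₁ ∞ s₁ w.1) (hs₂ : ContMDiffAt 𝓘(ℝ, E₂) I₂ ∞ s₂ w.2)
    {a a' : E₁} {b c c' : E₂}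
    (ha : J (i (s₁ w.1, s₂ w.2))
        (horizontalMap I₁ I₂ I i (s₁ w.1, s₂ w.2) (mfderiv 𝓘(ℝ, E₁) I₁ s₁ w.1 a)) =
      horizontalMap I₁ I₂ I i (s₁ w.1, s₂ w.2) (mfderiv 𝓘(ℝ, E₁) I₁ s₁ w.1 a'))
    (hc : J (i (s₁ w.1, s₂ w.2))
        (verticalMap I₁ I₂ I i (s₁ w.1, s₂ w.2) (mfderiv 𝓘(ℝ, E₂) I₂ s₂ w.2 c)) =
      verticalMap I₁ I₂ I i (s₁ w.1, s₂ w.2) (mfderiv 𝓘(ℝ, E₂) I₂ s₂ w.2 c')) :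
    logDifferential I₁ f (s₁ w.1) (mfderiv 𝓘(ℝ, E₁) I₁ s₁ w.1 a') *
      (inner ℝ (verticalMap I₁ I₂ I i (s₁ w.1, s₂ w.2) (mfderiv 𝓘(ℝ, E₂) I₂ s₂ w.2 b))
        (verticalMap I₁ I₂ I i (s₁ w.1, s₂ w.2) (mfderiv 𝓘(ℝ, E₂) I₂ s₂ w.2 c)) : ℝ) =
    logDifferential I₁ f (s₁ w.1) (mfderiv 𝓘(ℝ, E₁) I₁ s₁ w.1 a) *
      (inner ℝ (verticalMap I₁ I₂ I i (s₁ w.1, s₂ w.2) (mfderiv 𝓘(ℝ, E₂) I₂ s₂ w.2 b))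
        (verticalMap I₁ I₂ I i (s₁ w.1, s₂ w.2) (mfderiv 𝓘(ℝ, E₂) I₂ s₂ w.2 c')) : ℝ) := by
  obtain ⟨hJ0, nabla, hn, hpar⟩ := hJ
  set z : M₁ × M₂ := (s₁ w.1, s₂ w.2) with hz
  let h : E₁ × E₂ → M := fun w => i (s₁ w.1, s₂ w.2)
  obtain ⟨B, hBsymm, hB⟩ := hn.exists_hessian I (contMDiffAt_comp_prod hi hs₁ hs₂)
  have hBm := hB (fun y => innerₗ (TangentSpace I y)) (hn.isParallelForm_inner I)
  have hBJ := hB (fun y => (innerₗ (TangentSpace I y)).comp (J y).toLinearMap)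
    (hn.isParallelForm_inner_apply I hJ0.smooth hpar)
  have hL := eventually_mfderiv_comp_prod hi hs₁ hs₂
  let X : E₁ → TangentSpace I (h w) := fun a => mfderiv 𝓘(ℝ, E₁ × E₂) I h w (a, (0 : E₂))
  let V : E₂ → TangentSpace I (h w) := fun b => mfderiv 𝓘(ℝ, E₁ × E₂) I h w ((0 : E₁), b)
  have hLX : ∀ᶠ t in 𝓝 w, ∀ a : E₁, mfderiv 𝓘(ℝ, E₁ × E₂) I h t (a, (0 : E₂)) =
      horizontalMap I₁ I₂ I i (s₁ t.1, s₂ t.2) (mfderiv 𝓘(ℝ, E₁) I₁ s₁ t.1 a) := by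
    filter_upwards [hL] with t ht a
    refine (ht a 0).trans ((congrArg _ ?_).trans (add_zero _))
    exact (congrArg _ (map_zero (mfderiv 𝓘(ℝ, E₂) I₂ s₂ t.2))).trans (map_zero _)
  have hLV : ∀ᶠ t in 𝓝 w, ∀ b : E₂, mfderiv 𝓘(ℝ, E₁ × E₂) I h t ((0 : E₁), b) =
      verticalMap I₁ I₂ I i (s₁ t.1, s₂ t.2) (mfderiv 𝓘(ℝ, E₂) I₂ s₂ t.2 b) := by
    filter_upwards [hL] with t ht b
    refine (ht 0 b).trans ((congrArg (· + _) ?_).trans (zero_add _))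
    exact (congrArg _ (map_zero (mfderiv 𝓘(ℝ, E₁) I₁ s₁ t.1))).trans (map_zero _)
  have hG : ∀ (a : E₁) (c : E₂) (d : E₁ × E₂),
      (inner ℝ (B d (a, 0)) (V c) : ℝ) + inner ℝ (X a) (B d (0, c)) = 0 := by
    intro a c d
    refine ((hBm (a, 0) (0, c)).2 d).symm.trans ?_
    have : (fun t => innerₗ (TangentSpace I (h t)) (mfderiv 𝓘(ℝ, E₁ × E₂) I h t (a, (0 : E₂)))
        (mfderiv 𝓘(ℝ, E₁ × E₂) I h t ((0 : E₁), c))) =ᶠ[𝓝 w] fun _ => (0 : ℝ) := by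
      filter_upwards [hLX, hLV] with t h1 h2
      rw [h1, h2]
      exact hi.inner_horizontalMap_verticalMap _ _ _
    rw [this.fderiv_eq]
    simp
  have hK : ∀ (a : E₁) (c : E₂) (d : E₁ × E₂),
      (inner ℝ (J (h w) (B d (a, 0))) (V c) : ℝ) + inner ℝ (J (h w) (X a)) (B d (0, c)) = 0 := by
    intro a c d
    refine ((hBJ (a, 0) (0, c)).2 d).symm.trans ?_
    have : (fun t => ((innerₗ (TangentSpace I (h t))).comp (J (h t)).toLinearMap)
        (mfderiv 𝓘(ℝ, E₁ × E₂) I h t (a, (0 : E₂)))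
        (mfderiv 𝓘(ℝ, E₁ × E₂) I h t ((0 : E₁), c))) =ᶠ[𝓝 w] fun _ => (0 : ℝ) := by
      filter_upwards [hLX, hLV] with t h1 h2
      rw [h1, h2]
      obtain ⟨x', hx'⟩ := (h₁ (s₂ t.2)).exists_horizontalMap (z := (s₁ t.1, s₂ t.2)) hi
        (mfderiv 𝓘(ℝ, E₁) I₁ s₁ t.1 a)
      refine (congrArg (fun ξ => (inner ℝ ξ _ : ℝ)) hx').trans ?_
      exact hi.inner_horizontalMap_verticalMap _ _ _
    rw [this.fderiv_eq]
    simp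
  let ℓ' : E₁ → ℝ := fun a => logDifferential I₁ f (s₁ w.1) (mfderiv 𝓘(ℝ, E₁) I₁ s₁ w.1 a)
  have hD : ∀ (a : E₁) (b c : E₂),
      (inner ℝ (B (a, 0) (0, b)) (V c) : ℝ) + inner ℝ (V b) (B (a, 0) (0, c)) =
        2 * ℓ' a * inner ℝ (V b) (V c) := by
    intro a b c
    refine ((hBm (0, b) (0, c)).2 (a, 0)).symm.trans ?_
    have hd := (hBm (0, b) (0, c)).1.hasFDerivAt
    let C : ℝ := inner ℝ (mfderiv 𝓘(ℝ, E₂) I₂ s₂ w.2 b) (mfderiv 𝓘(ℝ, E₂) I₂ s₂ w.2 c)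
    have h1 := HasFDerivAt.comp w.1 (f := fun t => (t, w.2)) hd (hasFDerivAt_prodMk_left w.1 w.2)
    have hℓ : HasFDerivAt (fun t => Real.log (f (s₁ t)))
        (fderiv ℝ (fun t => Real.log (f (s₁ t))) w.1) w.1 :=
      (((hi.mdifferentiableAt_log (s₁ w.1)).comp w.1
        (hs₁.mdifferentiableAt (by simp))).differentiableAt).hasFDerivAt
    have hℓ' : fderiv ℝ (fun t => Real.log (f (s₁ t))) w.1 a = ℓ' a := by
      have := mfderiv_comp w.1 (hi.mdifferentiableAt_log (s₁ w.1))
        (hs₁.mdifferentiableAt (by simp))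
      rw [← mfderiv_eq_fderiv]
      exact DFunLike.congr_fun this a
    have h2 := ((hℓ.const_mul 2).exp).mul_const C
    have hev : ((fun t => innerₗ (TangentSpace I (h t))
          (mfderiv 𝓘(ℝ, E₁ × E₂) I h t ((0 : E₁), b))
          (mfderiv 𝓘(ℝ, E₁ × E₂) I h t ((0 : E₁), c))) ∘ fun t => (t, w.2)) =ᶠ[𝓝 w.1]
        fun t => Real.exp (2 * Real.log (f (s₁ t))) * C := by
      have hcont : ContinuousAt (fun t : E₁ => (t, w.2)) w.1 := by fun_prop
      filter_upwards [hcont.eventually hLV] with t ht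
      refine (congrArg₂ (fun ξ η => (inner ℝ ξ η : ℝ)) (ht b) (ht c)).trans ?_
      refine (hi.inner_verticalMap _ _ _).trans ?_
      rw [two_mul, Real.exp_add, Real.exp_log (hi.warping_pos _), sq]
    have h3 := h1.unique (h2.congr_of_eventuallyEq hev)
    have h4 := DFunLike.congr_fun h3 a
    have h5 : (inner ℝ (V b) (V c) : ℝ) = Real.exp (2 * Real.log (f (s₁ w.1))) * C :=
      hev.self_of_nhds
    rw [h5]
    refine h4.trans ?_
    simp only [smul_apply, smul_eq_mul, hℓ']
    ring
  have hS : ∀ (a : E₁) (b c : E₂), (inner ℝ (B (0, b) (a, 0)) (V c) : ℝ) =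
      ℓ' a * inner ℝ (V b) (V c) := by
    intro a b c
    have g1 := hG a c (0, b)
    have g2 := hG a b (0, c)
    have g3 := hD a b c
    rw [hBsymm (a, 0) (0, b), hBsymm (a, 0) (0, c), real_inner_comm (B (0, c) (a, 0))] at g3
    rw [hBsymm (0, c) (0, b)] at g2
    linarith
  have hX₀ : ∀ a, X a = horizontalMap I₁ I₂ I i z (mfderiv 𝓘(ℝ, E₁) I₁ s₁ w.1 a) :=
    hLX.self_of_nhds
  have hV₀ : ∀ b, V b = verticalMap I₁ I₂ I i z (mfderiv 𝓘(ℝ, E₂) I₂ s₂ w.2 b) :=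
    hLV.self_of_nhds
  have ha' : J (h w) (X a) = X a' := by rw [hX₀, hX₀]; exact ha
  have hc' : J (h w) (V c) = V c' := by rw [hV₀, hV₀]; exact hc
  have k1 := hK a c (0, b)
  have k2 := hG a' c (0, b)
  rw [hJ0.compatible, hc', ha', hS] at k1
  rw [hS] at k2
  have : ℓ' a' * (inner ℝ (V b) (V c) : ℝ) = ℓ' a * inner ℝ (V b) (V c') := by linarith
  rw [hV₀, hV₀, hV₀] at this
  exact this

end MetallicWarped

section Charts

open Topology

variable {E₁ : Type*} [NormedAddCommGroup E₁] [NormedSpace ℝ E₁]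
  {H₁ : Type*} [TopologicalSpace H₁] {I₁ : ModelWithCorners ℝ E₁ H₁} [I₁.Boundaryless]
  {M₁ : Type*} [TopologicalSpace M₁] [ChartedSpace H₁ M₁] [IsManifold I₁ ∞ M₁]
  {E₂ : Type*} [NormedAddCommGroup E₂] [NormedSpace ℝ E₂]
  {H₂ : Type*} [TopologicalSpace H₂] {I₂ : ModelWithCorners ℝ E₂ H₂} [I₂.Boundaryless]
  {M₂ : Type*} [TopologicalSpace M₂] [ChartedSpace H₂ M₂] [IsManifold I₂ ∞ M₂]

theorem contMDiffAt_extChartAt_symm {x : M₁} {w : E₁} (hw : w ∈ (extChartAt I₁ x).target) :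
    ContMDiffAt 𝓘(ℝ, E₁) I₁ ∞ (extChartAt I₁ x).symm w :=
  (contMDiffOn_extChartAt_symm x).contMDiffAt ((isOpen_extChartAt_target x).mem_nhds hw)

theorem isInvertible_mfderiv_extChartAt_symm {x : M₁} {w : E₁}
    (hw : w ∈ (extChartAt I₁ x).target) :
    (mfderiv 𝓘(ℝ, E₁) I₁ (extChartAt I₁ x).symm w).IsInvertible := by
  have : IsManifold I₁ 1 M₁ := IsManifold.of_le (n := ∞) (WithTop.coe_le_coe.2 le_top)
  have h := isInvertible_mfderivWithin_extChartAt_symm (I := I₁) hw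
  rwa [I₁.range_eq_univ, mfderivWithin_univ] at h

variable
  {E : Type*} [NormedAddCommGroup E] [NormedSpace ℝ E] [FiniteDimensional ℝ E] [CompleteSpace E]
  {H : Type*} [TopologicalSpace H] {I : ModelWithCorners ℝ E H}
  {M : Type*} [TopologicalSpace M] [ChartedSpace H M] [IsManifold I ∞ M] [T2Space M]
  [RiemannianBundle (fun x : M₁ => TangentSpace I₁ x)]
  [RiemannianBundle (fun x : M₂ => TangentSpace I₂ x)]
  [RiemannianBundle (fun x : M => TangentSpace I x)]
  [IsContMDiffRiemannianBundle I ∞ E (fun x : M => TangentSpace I x)]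
  {f : M₁ → ℝ} {i : M₁ × M₂ → M} {p q : ℕ}
  {J : (x : M) → TangentSpace I x →L[ℝ] TangentSpace I x}

/-- The relation `TX(ln f) g(U, V) = X(ln f) g(U, JV)` for horizontal `X` and vertical `U`, `V`. -/
theorem log_warping_identity (hJ : IsLocallyMetallic I p q J)
    (hi : IsWarpedProductSubmanifold I₁ I₂ I f i)
    (h₁ : ∀ y : M₂, IsInvariantSubmanifold I₁ I J (fun x : M₁ => i (x, y))) (z : M₁ × M₂) :
    ∀ (x x' : TangentSpace I₁ z.1) (u v v' : TangentSpace I₂ z.2),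
      J (i z) (horizontalMap I₁ I₂ I i z x) = horizontalMap I₁ I₂ I i z x' →
      J (i z) (verticalMap I₁ I₂ I i z v) = verticalMap I₁ I₂ I i z v' →
      logDifferential I₁ f z.1 x' *
          (inner ℝ (verticalMap I₁ I₂ I i z u) (verticalMap I₁ I₂ I i z v) : ℝ) =
        logDifferential I₁ f z.1 x *
          (inner ℝ (verticalMap I₁ I₂ I i z u) (verticalMap I₁ I₂ I i z v') : ℝ) := by
  have hw₁ := mem_extChartAt_target (I := I₁) z.1
  have hw₂ := mem_extChartAt_target (I := I₂) z.2
  have hz : ((extChartAt I₁ z.1).symm (extChartAt I₁ z.1 z.1),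
      (extChartAt I₂ z.2).symm (extChartAt I₂ z.2 z.2)) = z :=
    Prod.ext (extChartAt_to_inv z.1) (extChartAt_to_inv z.2)
  rw [← hz]
  intro x x' u v v' hx hv
  obtain ⟨a, rfl⟩ := (isInvertible_mfderiv_extChartAt_symm hw₁).bijective.surjective x
  obtain ⟨a', rfl⟩ := (isInvertible_mfderiv_extChartAt_symm hw₁).bijective.surjective x'
  obtain ⟨b, rfl⟩ := (isInvertible_mfderiv_extChartAt_symm hw₂).bijective.surjective u
  obtain ⟨c, rfl⟩ := (isInvertible_mfderiv_extChartAt_symm hw₂).bijective.surjective v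
  obtain ⟨c', rfl⟩ := (isInvertible_mfderiv_extChartAt_symm hw₂).bijective.surjective v'
  exact log_warping_identity_of_parametrization
    (w := (extChartAt I₁ z.1 z.1, extChartAt I₂ z.2 z.2)) hJ hi h₁
    (contMDiffAt_extChartAt_symm hw₁) (contMDiffAt_extChartAt_symm hw₂) hx hv

/-- Near every point there is a nonvanishing vertical vector field `V` along which `g(V, V)` and
`g(JV, V)` are continuous. -/
theorem exists_continuousAt_inner_verticalMap [Nontrivial E₂] (hJ : IsLocallyMetallic I p q J)
    (hi : IsWarpedProductSubmanifold I₁ I₂ I f i) (z₀ : M₁ × M₂) :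
    ∃ g k : M₁ × M₂ → ℝ, ContinuousAt g z₀ ∧ ContinuousAt k z₀ ∧
      ∀ᶠ z in 𝓝 z₀, ∃ v : TangentSpace I₂ z.2, v ≠ 0 ∧
        g z = inner ℝ (verticalMap I₁ I₂ I i z v) (verticalMap I₁ I₂ I i z v) ∧
        k z = inner ℝ (J (i z) (verticalMap I₁ I₂ I i z v)) (verticalMap I₁ I₂ I i z v) := by
  obtain ⟨b, hb⟩ := exists_ne (0 : E₂)
  obtain ⟨hJ0, nabla, hn, hpar⟩ := hJ
  let φ : M₁ × M₂ → E₁ × E₂ := fun z => (extChartAt I₁ z₀.1 z.1, extChartAt I₂ z₀.2 z.2)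
  let s₁ := (extChartAt I₁ z₀.1).symm
  let s₂ := (extChartAt I₂ z₀.2).symm
  have hs₁ : ContMDiffAt 𝓘(ℝ, E₁) I₁ ∞ s₁ (φ z₀).1 :=
    contMDiffAt_extChartAt_symm (mem_extChartAt_target z₀.1)
  have hs₂ : ContMDiffAt 𝓘(ℝ, E₂) I₂ ∞ s₂ (φ z₀).2 :=
    contMDiffAt_extChartAt_symm (mem_extChartAt_target z₀.2)
  have hφ : ContinuousAt φ z₀ :=
    ((continuousAt_extChartAt (I := I₁) z₀.1).comp continuousAt_fst).prodMk
      ((continuousAt_extChartAt (I := I₂) z₀.2).comp continuousAt_snd)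
  let h : E₁ × E₂ → M := fun w => i (s₁ w.1, s₂ w.2)
  obtain ⟨B, -, hB⟩ := hn.exists_hessian I (contMDiffAt_comp_prod hi hs₁ hs₂)
  have hBm := (hB (fun y => innerₗ (TangentSpace I y)) (hn.isParallelForm_inner I)
    (0, b) (0, b)).1.continuousAt
  have hBJ := (hB (fun y => (innerₗ (TangentSpace I y)).comp (J y).toLinearMap)
    (hn.isParallelForm_inner_apply I hJ0.smooth hpar) (0, b) (0, b)).1.continuousAt
  refine ⟨_, _, hBm.comp hφ, hBJ.comp hφ, ?_⟩
  have hsrc₁ : ∀ᶠ z : M₁ × M₂ in 𝓝 z₀, z.1 ∈ (extChartAt I₁ z₀.1).source :=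
    continuousAt_fst.eventually (extChartAt_source_mem_nhds z₀.1)
  have hsrc₂ : ∀ᶠ z : M₁ × M₂ in 𝓝 z₀, z.2 ∈ (extChartAt I₂ z₀.2).source :=
    continuousAt_snd.eventually (extChartAt_source_mem_nhds z₀.2)
  filter_upwards [hφ.eventually (eventually_mfderiv_comp_prod hi hs₁ hs₂), hsrc₁, hsrc₂]
    with z hz hz₁ hz₂
  have hL : mfderiv 𝓘(ℝ, E₁ × E₂) I h (φ z) ((0 : E₁), b) =
      verticalMap I₁ I₂ I i (s₁ (φ z).1, s₂ (φ z).2) (mfderiv 𝓘(ℝ, E₂) I₂ s₂ (φ z).2 b) := by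
    refine (hz 0 b).trans ((congrArg (· + _) ?_).trans (zero_add _))
    exact (congrArg _ (map_zero (mfderiv 𝓘(ℝ, E₁) I₁ s₁ (φ z).1))).trans (map_zero _)
  have hv : mfderiv 𝓘(ℝ, E₂) I₂ s₂ (φ z).2 b ≠ 0 := fun h0 => hb <|
    (isInvertible_mfderiv_extChartAt_symm ((extChartAt I₂ z₀.2).map_source hz₂)).bijective.injective
      (h0.trans (map_zero _).symm)
  have key : ∃ v : TangentSpace I₂ (s₁ (φ z).1, s₂ (φ z).2).2, v ≠ 0 ∧
      (inner ℝ (mfderiv 𝓘(ℝ, E₁ × E₂) I h (φ z) ((0 : E₁), b))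
        (mfderiv 𝓘(ℝ, E₁ × E₂) I h (φ z) ((0 : E₁), b)) : ℝ) =
        inner ℝ (verticalMap I₁ I₂ I i (s₁ (φ z).1, s₂ (φ z).2) v)
          (verticalMap I₁ I₂ I i (s₁ (φ z).1, s₂ (φ z).2) v) ∧
      (inner ℝ (J (h (φ z)) (mfderiv 𝓘(ℝ, E₁ × E₂) I h (φ z) ((0 : E₁), b)))
        (mfderiv 𝓘(ℝ, E₁ × E₂) I h (φ z) ((0 : E₁), b)) : ℝ) =
        inner ℝ (J (i (s₁ (φ z).1, s₂ (φ z).2))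
          (verticalMap I₁ I₂ I i (s₁ (φ z).1, s₂ (φ z).2) v))
          (verticalMap I₁ I₂ I i (s₁ (φ z).1, s₂ (φ z).2) v) :=
    ⟨_, hv, by rw [hL], by rw [hL]⟩
  have hzz : (s₁ (φ z).1, s₂ (φ z).2) = z :=
    Prod.ext ((extChartAt I₁ z₀.1).left_inv hz₁) ((extChartAt I₂ z₀.2).left_inv hz₂)
  generalize hm : (inner ℝ (mfderiv 𝓘(ℝ, E₁ × E₂) I h (φ z) ((0 : E₁), b))
        (mfderiv 𝓘(ℝ, E₁ × E₂) I h (φ z) ((0 : E₁), b)) : ℝ) = m at key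
  generalize hk : (inner ℝ (J (h (φ z)) (mfderiv 𝓘(ℝ, E₁ × E₂) I h (φ z) ((0 : E₁), b)))
        (mfderiv 𝓘(ℝ, E₁ × E₂) I h (φ z) ((0 : E₁), b)) : ℝ) = k at key
  rw [hzz] at key
  obtain ⟨v, hv0, hv1, hv2⟩ := key
  exact ⟨v, hv0, hm.trans hv1, hk.trans hv2⟩

end Charts

section Metallic

theorem metallicNumber_sq (p q : ℕ) :
    metallicNumber p q ^ 2 = p * metallicNumber p q + q := by
  have h : Real.sqrt ((p : ℝ) ^ 2 + 4 * (q : ℝ)) ^ 2 = (p : ℝ) ^ 2 + 4 * q :=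
    Real.sq_sqrt (by positivity)
  unfold metallicNumber
  linear_combination h / 4

theorem eq_metallicNumber_or_of_sq {p q : ℕ} {α : ℝ} (h : α ^ 2 - p * α - q = 0) :
    α = metallicNumber p q ∨ α = p - metallicNumber p q := by
  have : (α - metallicNumber p q) * (α - (p - metallicNumber p q)) = 0 := by
    linear_combination h - metallicNumber_sq p q
  rcases mul_eq_zero.1 this with h | h
  · exact Or.inl (sub_eq_zero.1 h)
  · exact Or.inr (sub_eq_zero.1 h)

end Metallic

theorem propositionp3
    (p q : ℕ) (hp : 0 < p) (hq : 0 < q) (m n₁ n₂ : ℕ) (hn₂ : 0 < n₂)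
    -- the ambient locally metallic Riemannian manifold
    {M : Type*} [TopologicalSpace M] [T2Space M] [SecondCountableTopology M]
    [ChartedSpace (EuclideanSpace ℝ (Fin m)) M] [IsManifold (𝓡 m) ∞ M]
    [RiemannianBundle (fun x : M => TangentSpace (𝓡 m) x)]
    [IsContMDiffRiemannianBundle (𝓡 m) ∞ (EuclideanSpace ℝ (Fin m))
      (fun x : M => TangentSpace (𝓡 m) x)]
    -- the two Riemannian factors
    {M₁ : Type*} [TopologicalSpace M₁] [T2Space M₁] [SecondCountableTopology M₁]
    [ChartedSpace (EuclideanSpace ℝ (Fin n₁)) M₁] [IsManifold (𝓡 n₁) ∞ M₁]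
    [RiemannianBundle (fun x : M₁ => TangentSpace (𝓡 n₁) x)]
    [IsContMDiffRiemannianBundle (𝓡 n₁) ∞ (EuclideanSpace ℝ (Fin n₁))
      (fun x : M₁ => TangentSpace (𝓡 n₁) x)]
    {M₂ : Type*} [TopologicalSpace M₂] [T2Space M₂] [SecondCountableTopology M₂]
    [ChartedSpace (EuclideanSpace ℝ (Fin n₂)) M₂] [IsManifold (𝓡 n₂) ∞ M₂]
    [RiemannianBundle (fun x : M₂ => TangentSpace (𝓡 n₂) x)]
    [IsContMDiffRiemannianBundle (𝓡 n₂) ∞ (EuclideanSpace ℝ (Fin n₂))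
      (fun x : M₂ => TangentSpace (𝓡 n₂) x)]
    (J : (x : M) → TangentSpace (𝓡 m) x →L[ℝ] TangentSpace (𝓡 m) x)
    (hJ : IsLocallyMetallic (𝓡 m) p q J)
    (f : M₁ → ℝ) (i : M₁ × M₂ → M)
    (hi : IsWarpedProductSubmanifold (𝓡 n₁) (𝓡 n₂) (𝓡 m) f i)
    -- the leaves `M₁ × {y}` and `{x} × M₂` are invariant submanifolds
    (h₁ : ∀ y : M₂, IsInvariantSubmanifold (𝓡 n₁) (𝓡 m) J (fun x : M₁ => i (x, y)))
    (h₂ : ∀ x : M₁, IsInvariantSubmanifold (𝓡 n₂) (𝓡 m) J (fun y : M₂ => i (x, y)))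
    (X : (x : M₁) → TangentSpace (𝓡 n₁) x) (hX : IsSmoothVectorField (𝓡 n₁) X)
    -- `Xlnf = X(ln f)` and `TXlnf = TX(ln f)`, as functions on `M₁ × M₂`
    (Xlnf TXlnf : M₁ × M₂ → ℝ)
    (hXlnf : Xlnf = derivAlong ((𝓡 n₁).prod (𝓡 n₂)) (horizontalLift (𝓡 n₁) (𝓡 n₂) X)
      (fun w => Real.log (f w.1)))
    (hTXlnf : TXlnf = derivAlong ((𝓡 n₁).prod (𝓡 n₂))
      (tangentialField ((𝓡 n₁).prod (𝓡 n₂)) (𝓡 m) J i (horizontalLift (𝓡 n₁) (𝓡 n₂) X))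
      (fun w => Real.log (f w.1))) :
    (∀ z : M₁ × M₂, Xlnf z ≠ 0 →
      (TXlnf z / Xlnf z) ^ 2 - (p : ℝ) * (TXlnf z / Xlnf z) - (q : ℝ) = 0 ∧
      (TXlnf z = metallicNumber p q * Xlnf z ∨
        TXlnf z = ((p : ℝ) - metallicNumber p q) * Xlnf z)) ∧
    (∀ S : Set (M₁ × M₂), IsPreconnected S → (∀ z ∈ S, Xlnf z ≠ 0) →
      (∀ z ∈ S, TXlnf z = metallicNumber p q * Xlnf z) ∨
        (∀ z ∈ S, TXlnf z = ((p : ℝ) - metallicNumber p q) * Xlnf z)) := by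
  have : Nonempty (Fin n₂) := ⟨⟨0, hn₂⟩⟩
  have hXz : ∀ z, Xlnf z = logDifferential (𝓡 n₁) f z.1 (X z.1) := fun z => by
    rw [hXlnf, hi.derivAlong_log]
    rfl
  have hTz : ∀ z, ∃ x', J (i z) (horizontalMap (𝓡 n₁) (𝓡 n₂) (𝓡 m) i z (X z.1)) =
      horizontalMap (𝓡 n₁) (𝓡 n₂) (𝓡 m) i z x' ∧
      TXlnf z = logDifferential (𝓡 n₁) f z.1 x' := fun z => by
    obtain ⟨x', hx'⟩ := (h₁ z.2).exists_horizontalMap hi (X z.1)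
    refine ⟨x', hx', ?_⟩
    rw [hTXlnf, hi.derivAlong_log, ← hi.tangentialPart_horizontalMap z x', ← hx']
    rfl
  have hkey : ∀ (z : M₁ × M₂) (u v v' : TangentSpace (𝓡 n₂) z.2),
      J (i z) (verticalMap (𝓡 n₁) (𝓡 n₂) (𝓡 m) i z v) =
        verticalMap (𝓡 n₁) (𝓡 n₂) (𝓡 m) i z v' →
      TXlnf z * (inner ℝ (verticalMap (𝓡 n₁) (𝓡 n₂) (𝓡 m) i z u)
          (verticalMap (𝓡 n₁) (𝓡 n₂) (𝓡 m) i z v) : ℝ) =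
        Xlnf z * (inner ℝ (verticalMap (𝓡 n₁) (𝓡 n₂) (𝓡 m) i z u)
          (verticalMap (𝓡 n₁) (𝓡 n₂) (𝓡 m) i z v') : ℝ) := by
    intro z u v v' hv
    obtain ⟨x', hx', hT⟩ := hTz z
    rw [hT, hXz]
    exact log_warping_identity hJ hi h₁ z _ _ u v v' hx' hv
  have hpos : ∀ (z : M₁ × M₂) (v : TangentSpace (𝓡 n₂) z.2), v ≠ 0 →
      (0 : ℝ) < inner ℝ (verticalMap (𝓡 n₁) (𝓡 n₂) (𝓡 m) i z v)
        (verticalMap (𝓡 n₁) (𝓡 n₂) (𝓡 m) i z v) := by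
    intro z v hv
    rw [hi.inner_verticalMap]
    exact mul_pos (pow_pos (hi.warping_pos _) 2) (real_inner_self_pos.2 hv)
  have hquad : ∀ z, Xlnf z ≠ 0 →
      (TXlnf z / Xlnf z) ^ 2 - (p : ℝ) * (TXlnf z / Xlnf z) - (q : ℝ) = 0 := by
    intro z hz
    obtain ⟨v, hv⟩ : ∃ v : TangentSpace (𝓡 n₂) z.2, v ≠ 0 :=
      exists_ne (0 : EuclideanSpace ℝ (Fin n₂))
    obtain ⟨v', hv'⟩ := (h₂ z.1).exists_verticalMap hi v
    obtain ⟨v'', hv''⟩ := (h₂ z.1).exists_verticalMap hi v'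
    have e1 := hkey z v v v' hv'
    have e2 := hkey z v v' v'' hv''
    have e3 := hJ.1.sq_eq (i z) (verticalMap (𝓡 n₁) (𝓡 n₂) (𝓡 m) i z v)
    rw [hv', hv''] at e3
    rw [e3, inner_add_right, real_inner_smul_right, real_inner_smul_right] at e2
    have hN := hpos z v hv
    have e4 : (TXlnf z ^ 2 - p * TXlnf z * Xlnf z - q * Xlnf z ^ 2) *
        (inner ℝ (verticalMap (𝓡 n₁) (𝓡 n₂) (𝓡 m) i z v)
          (verticalMap (𝓡 n₁) (𝓡 n₂) (𝓡 m) i z v) : ℝ) = 0 := by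
      linear_combination (TXlnf z - p * Xlnf z) * e1 + Xlnf z * e2
    have e5 := (mul_eq_zero.1 e4).resolve_right hN.ne'
    field_simp
    linear_combination e5
  refine ⟨fun z hz => ⟨hquad z hz, ?_⟩, fun S hS hSz => ?_⟩
  · rcases eq_metallicNumber_or_of_sq (hquad z hz) with h | h
    · exact Or.inl ((div_eq_iff hz).1 h)
    · exact Or.inr ((div_eq_iff hz).1 h)
  · have hcont : ContinuousOn (fun z => TXlnf z / Xlnf z) S := by
      intro z₀ hz₀
      obtain ⟨g, k, hg, hk, hev⟩ := exists_continuousAt_inner_verticalMap hJ hi z₀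
      have hratio : ∀ᶠ z in nhds z₀, g z ≠ 0 ∧ TXlnf z * g z = Xlnf z * k z := by
        filter_upwards [hev] with z hz
        obtain ⟨v, hv, hgz, hkz⟩ := hz
        obtain ⟨v', hv'⟩ := (h₂ z.1).exists_verticalMap hi v
        refine ⟨hgz ▸ (hpos z v hv).ne', ?_⟩
        rw [hgz, hkz, hJ.1.compatible, hv']
        exact hkey z v v v' hv'
      have heq : ∀ z ∈ S, (g z ≠ 0 ∧ TXlnf z * g z = Xlnf z * k z) →
          TXlnf z / Xlnf z = k z / g z := fun z hz h => by
        rw [div_eq_div_iff (hSz z hz) h.1, h.2, mul_comm]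
      refine ((hk.div hg hratio.self_of_nhds.1).continuousWithinAt (s := S)).congr_of_eventuallyEq
        ?_ (heq z₀ hz₀ hratio.self_of_nhds)
      filter_upwards [nhdsWithin_le_nhds hratio, self_mem_nhdsWithin] with z hz hzS
        using heq z hzS hz
    obtain ⟨α, hα, hconst⟩ := hS.eqOn_const_of_mapsTo
      (T := {metallicNumber p q, (p : ℝ) - metallicNumber p q}) (Set.toFinite _).isDiscrete
      hcont (fun z hz => eq_metallicNumber_or_of_sq (hquad z (hSz z hz))) ⟨_, Or.inl rfl⟩
    rcases hα with rfl | rfl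
    · exact Or.inl fun z hz => (div_eq_iff (hSz z hz)).1 (hconst hz)
    · exact Or.inr fun z hz => (div_eq_iff (hSz z hz)).1 (hconst hz)
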